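/- Let $n\ge 1$ and let $\mathcal S$ be the set of $n$-qubit states, i.e. positive semidefinite complex $2^n\times 2^n$ matrices of trace one. In each round $t=1,2,\dots,T$ a learner predicts a state $\omega_t\in\mathcal S$; then an adversary, which may use the prediction $\omega_t$ and all earlier rounds, presents a two-outcome measurement $E_t$ (a Hermitian matrix with $0\le E_t\le I$) and a real target $b_t$. The loss function is $\ell_t(z)=(z-b_t)^2$, the learner suffers $\ell_t(\operatorname{Tr}E_t\omega_t)$, and $\nabla_t=2(\operatorname{Tr}(E_t\omega_t)-b_t)E_t$. Assume that the targets are bounded, $|b_t|\le B$ for all $t$. Write $$L_T^*=\min_{\omega\in\mathcal S}\sum_{t=1}^T\ell_t(\operatorname{Tr}E_t\omega),\qquad \operatorname{Reg}_T=\sum_{t=1}^T\ell_t(\operatorname{Tr}E_t\omega_t)-L_T^*.$$ The learner uses the following doubling trick. The rounds are divided into consecutive blocks $\beta=1,2,\dots$; block $\beta$ starts in round $T_\beta$, with $T_1=1$, and uses the learning rate $\eta_\beta=\min\{\sqrt{n\ln 2/(2^\beta+1)},\,1/2\}$. If $t=T_\beta$, the learner predicts $\omega_t=2^{-n}I$.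 In every later round $t$ of block $\beta$ it predicts, according to which of two methods has been fixed in advance, either (MEG) $$\omega_t=\frac{\exp(\log\omega_{t-1}-\eta_\beta\nabla_{t-1})}{\operatorname{Tr}\exp(\log\omega_{t-1}-\eta_\beta\nabla_{t-1})},$$ or (RFTL with von Neumann entropy) $$\omega_t\in\operatorname*{arg\,min}_{\omega\in\mathcal S}\Bigl\{\eta_\beta\sum_{s=T_\beta}^{t-1}\operatorname{Tr}(\nabla_s\omega)+\operatorname{Tr}(\omega\log\omega)\Bigr\}.$$ If after round $t$ of block $\beta$ one has $\sum_{s=T_\beta}^{t}\ell_s(\operatorname{Tr}E_s\omega_s)\ge 2^\beta$, then block $\beta+1$ starts in round $T_{\beta+1}=t+1$. Then there is a constant $C$ that depends only on $B$ such that for all $n\ge1$ and $T\ge2$, for either method and every such adversary, the algorithm can be run and every run of it satisfies $$\operatorname{Reg}_T\le C\left(\sqrt{n\,L_T^*\log T}+n\log T\right).$$ -/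

import Mathlib

namespace QuantumOnline

open scoped ComplexOrder

noncomputable section

/-- Operators on the state space of `n` qubits, as complex `2 ^ n × 2 ^ n` matrices. -/
abbrev Op (n : ℕ) : Type := Matrix (Fin (2 ^ n)) (Fin (2 ^ n)) ℂ

/-- A quantum state: a positive semidefinite matrix of trace one. -/
def IsState {n : ℕ} (ρ : Op n) : Prop := ρ.PosSemidef ∧ ρ.trace = 1

/-- A two-outcome measurement: a Hermitian matrix `E` with `0 ≤ E ≤ 1`, that is, with eigenvalues
in `[0, 1]`. -/
def IsMeasurement {n : ℕ} (E : Op n) : Prop := E.PosSemidef ∧ (1 - E).PosSemidef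

/-- `Tr (E ω)`, as a real number (the trace is real for Hermitian `E` and `ω`). -/
def expect {n : ℕ} (E ω : Op n) : ℝ := (E * ω).trace.re

/-- The maximally mixed state `2 ^ (-n) I`. -/
def mixed (n : ℕ) : Op n := ((2 : ℝ) ^ n)⁻¹ • (1 : Op n)

/-- The matrix logarithm of a Hermitian matrix, by functional calculus (`log` acts on the
eigenvalues; the eigenvalue `0` is sent to `0`, so that `ω * matLog ω` follows the convention
`0 log 0 = 0`). -/
def matLog {n : ℕ} (ω : Op n) : Op n := cfc Real.log ω

/-- What happens in one round: the learner's prediction `ω`, the measurement `E` and the target `b`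
presented to the learner. -/
structure Round (n : ℕ) where
  ω : Op n
  E : Op n
  b : ℝ

namespace Round

variable {n : ℕ}

/-- The squared loss `ℓ (Tr (E φ)) = (Tr (E φ) - b) ^ 2` of a state `φ` in a round. -/
def lossOf (r : Round n) (φ : Op n) : ℝ := (expect r.E φ - r.b) ^ 2

/-- The learner's own loss in a round. -/
def loss (r : Round n) : ℝ := r.lossOf r.ω

/-- The gradient `∇ = 2 (Tr (E ω) - b) E`. -/
def grad (r : Round n) : Op n := (2 * (expect r.E r.ω - r.b)) • r.E

end Round

/-- An adaptive adversary: in round `t` (rounds are numbered from `0`) it sees all earlier rounds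
and the current prediction, and answers with a two-outcome measurement and a target. -/
structure Adversary (n : ℕ) where
  meas : (t : ℕ) → (Fin t → Round n) → Op n → Op n
  target : (t : ℕ) → (Fin t → Round n) → Op n → ℝ
  isMeasurement : ∀ t past ω, IsMeasurement (meas t past ω)

/-- The two update methods. -/
inductive Update
  | MEG
  | RFTL

/-- The learning rate `min {√(n ln 2 / (2 ^ β + 1)), 1 / 2}` of block `β`. -/
def rate (n β : ℕ) : ℝ := min (√(n * Real.log 2 / (2 ^ β + 1))) (1 / 2)

/-- Matrix exponentiated gradient: `exp G / Tr (exp G)` with `G = log ω - η ∇`. -/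
def megUpdate {n : ℕ} (ω grad : Op n) (η : ℝ) : Op n :=
  (NormedSpace.exp (matLog ω - η • grad)).trace⁻¹ • NormedSpace.exp (matLog ω - η • grad)

/-- The objective `η ∑ Tr (∇ₛ ω) + Tr (ω log ω)` of regularized follow-the-leader with the
von Neumann entropy, over the rounds `s` with `start ≤ s < t`. -/
def rftlObjective {n : ℕ} (x : ℕ → Round n) (start t : ℕ) (η : ℝ) (ω : Op n) : ℝ :=
  η * (∑ s ∈ Finset.Ico start t, expect (x s).grad ω) + expect ω (matLog ω)

/-- The index `β` of the current block and the round in which that block started, at the beginning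
of round `t`. The first block has index `1` and starts in the first round (round `0`). After
a round in which the cumulative loss inside the current block is at least `2 ^ β`, a new block is
started. -/
def block {n : ℕ} (x : ℕ → Round n) : ℕ → ℕ × ℕ
  | 0 => (1, 0)
  | t + 1 =>
    if (2 : ℝ) ^ (block x t).1 ≤ ∑ s ∈ Finset.Icc (block x t).2 t, (x s).loss then
      ((block x t).1 + 1, t + 1)
    else block x t

/-- `ω` is a prediction of the doubling trick algorithm in round `t`, given the earlier rounds:
the maximally mixed state in the first round of a block, and otherwise the result of the chosen
update with the learning rate of the block (for RFTL: a minimizer, over the states, of the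
objective that sums over the earlier rounds of the block). -/
def IsPrediction {n : ℕ} (u : Update) (x : ℕ → Round n) (t : ℕ) (ω : Op n) : Prop :=
  if t = (block x t).2 then ω = mixed n
  else match u with
    | Update.MEG => ω = megUpdate (x (t - 1)).ω (x (t - 1)).grad (rate n (block x t).1)
    | Update.RFTL => IsState ω ∧
        IsMinOn (rftlObjective x (block x t).2 t (rate n (block x t).1)) {φ | IsState φ} ω

/-- `x` is, in its first `T` rounds, a run of the doubling trick algorithm with update method `u`
against the adversary `A`. -/
structure IsRun {n : ℕ} (u : Update) (A : Adversary n) (T : ℕ) (x : ℕ → Round n) : Prop where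
  predict : ∀ t < T, IsPrediction u x t (x t).ω
  meas : ∀ t < T, (x t).E = A.meas t (fun s => x s) (x t).ω
  target : ∀ t < T, (x t).b = A.target t (fun s => x s) (x t).ω

/-- The loss over `T` rounds of the best fixed state in hindsight (an infimum of nonnegative numbers
over the nonempty compact set of states, hence a minimum). -/
def bestLoss {n : ℕ} (x : ℕ → Round n) (T : ℕ) : ℝ :=
  ⨅ φ : {φ : Op n // IsState φ}, ∑ t ∈ Finset.range T, (x t).lossOf φ

/-- The regret over `T` rounds. -/
def regret {n : ℕ} (x : ℕ → Round n) (T : ℕ) : ℝ :=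
  (∑ t ∈ Finset.range T, (x t).loss) - bestLoss x T

end

end QuantumOnline

/-!
Write `Z(K) = Tr (exp K)`. Within a block, both methods predict the same state, the Gibbs state
`exp K / Z(K)` with `K = -η ∑ ∇ₛ` (`isPrediction_iff`): the MEG update only adds `-η ∇` to `K`, since
multiples of the identity are absorbed by the normalization, and by the Gibbs variational principle
(`gibbs_variational`) the RFTL objective has this state as its unique minimizer.

The regret inside a block is controlled by the free energy `log Z(K)`. It starts at `n log 2`, it
always dominates `Tr (K φ)` for every state `φ` (`expect_le_log_partition`), and one round with
gradient `∇ = 2 (z - b) E`, where `z = Tr (E ω)`, changes it by at most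
`-η Tr (∇ ω) + 12 η² ℓ` (`log_partition_add_smul_le`). The last point is where noncommutativity
matters. Instead of the Golden-Thompson inequality, the proof writes all the traces `Tr (f(X) g(Y))`
involved as sums over pairs of eigenvalues with the common nonnegative weights `|⟨uᵢ, vⱼ⟩|²`
(`exists_trace_cfc_mul_cfc`), which reduces the operator inequality to a scalar one for `exp`; the
variational principle is obtained in the same way from a scalar inequality for `q log q`. Together
with convexity of the loss this gives a regret of at most `n log 2 / η + 12 η ∑ ℓ` in the block.

In block `β` the learner's loss is at most `2 ^ β` plus the loss of one round, so the rate of the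
block bounds the regret by a multiple of `√(n 2 ^ β) + n`. Over the blocks these bounds add up
geometrically to a multiple of `√(n 2 ^ k) + n k`, where `k` is the last block
(`IsRun.block_invariant`). As every completed block `i` costs at least `2 ^ i`, the number `2 ^ k` is
at most the total loss plus `2`; in particular `k = O(log T)`. Hence the regret `R` satisfies
`R = O(√(n (R + L*)) + n log T)`, and solving for `R` proves the claim (`self_bounding`).
-/

namespace QuantumOnline

open scoped ComplexOrder Matrix

noncomputable section

/-! ### Functional calculus and traces of products -/

section Spectral

variable {ι : Type*} [Fintype ι] [DecidableEq ι]

theorem trace_cfc {X : Matrix ι ι ℂ} (hX : X.IsHermitian) (f : ℝ → ℝ) :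
    (cfc f X).trace = ((∑ i, f (hX.eigenvalues i) : ℝ) : ℂ) := by
  rw [hX.cfc_eq, Matrix.IsHermitian.cfc, Unitary.conjStarAlgAut_apply, Matrix.trace_mul_comm,
    ← mul_assoc, Unitary.coe_star_mul_self, one_mul, Matrix.trace_diagonal]
  simp

/-- Traces `Tr (f(X) g(Y))` are computed in the two eigenbases, with weights
`p i j = |⟨uᵢ, vⱼ⟩|²` that do not depend on `f` and `g`. An inequality between sums of products
`f(x) g(y)` of real functions thereby passes to traces, although `X` and `Y` need not commute. -/
theorem exists_trace_cfc_mul_cfc {X Y : Matrix ι ι ℂ} (hX : X.IsHermitian)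
    (hY : Y.IsHermitian) :
    ∃ p : ι → ι → ℝ, (∀ i j, 0 ≤ p i j) ∧ ∀ f g : ℝ → ℝ,
      (cfc f X * cfc g Y).trace.re =
        ∑ i, ∑ j, p i j * (f (hX.eigenvalues i) * g (hY.eigenvalues j)) := by
  set U : Matrix ι ι ℂ := (hX.eigenvectorUnitary).1
  set V : Matrix ι ι ℂ := (hY.eigenvectorUnitary).1
  refine ⟨fun i j => Complex.normSq ((star U * V) i j), fun i j => Complex.normSq_nonneg _,
    fun f g => ?_⟩
  have h : (cfc f X * cfc g Y).trace =
      (Matrix.diagonal (fun i => ((f (hX.eigenvalues i) : ℝ) : ℂ)) * (star U * V) *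
        Matrix.diagonal (fun i => ((g (hY.eigenvalues i) : ℝ) : ℂ)) * star (star U * V)).trace := by
    rw [hX.cfc_eq, hY.cfc_eq, Matrix.IsHermitian.cfc, Matrix.IsHermitian.cfc,
      Unitary.conjStarAlgAut_apply, Unitary.conjStarAlgAut_apply, mul_assoc, mul_assoc,
      Matrix.trace_mul_comm]
    simp only [star_mul, star_star, mul_assoc]
    rfl
  rw [h, Matrix.trace, Complex.re_sum]
  refine Finset.sum_congr rfl fun i _ => ?_
  rw [Matrix.diag_apply, Matrix.mul_apply, Complex.re_sum]
  refine Finset.sum_congr rfl fun j _ => ?_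
  rw [Matrix.mul_diagonal, Matrix.diagonal_mul, Matrix.star_apply]
  change _ = Complex.normSq ((star U * V) i j) * _
  generalize (star U * V) i j = w
  simp [Complex.normSq_apply]
  ring

theorem exp_eq_cfc {K : Matrix ι ι ℂ} (hK : K.IsHermitian) :
    NormedSpace.exp K = cfc Real.exp K := by
  open scoped Matrix.Norms.L2Operator in
  exact (CFC.real_exp_eq_normedSpace_exp (a := K) hK).symm

theorem continuousOn_spectrum (K : Matrix ι ι ℂ) (f : ℝ → ℝ) :
    ContinuousOn f (spectrum ℝ K) :=
  K.finite_real_spectrum.continuousOn f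

theorem isHermitian_cfc (f : ℝ → ℝ) (K : Matrix ι ι ℂ) : (cfc f K).IsHermitian :=
  cfc_predicate (R := ℝ) f K

theorem posSemidef_cfc {K : Matrix ι ι ℂ} (hK : K.IsHermitian) {f : ℝ → ℝ} (hf : ∀ x, 0 ≤ f x) :
    (cfc f K).PosSemidef := by
  rw [hK.cfc_eq, Matrix.IsHermitian.cfc, Unitary.conjStarAlgAut_apply]
  refine Matrix.PosSemidef.mul_mul_conjTranspose_same ?_ _
  exact Matrix.PosSemidef.diagonal fun i => by simpa using hf _

theorem re_trace_mul_nonneg {P Q : Matrix ι ι ℂ} (hP : P.PosSemidef) (hQ : Q.PosSemidef) :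
    0 ≤ (P * Q).trace.re := by
  obtain ⟨p, hp, h⟩ := exists_trace_cfc_mul_cfc hP.1 hQ.1
  have h' := h (fun x => x) (fun x => x)
  rw [cfc_id' ℝ P hP.1.isSelfAdjoint, cfc_id' ℝ Q hQ.1.isSelfAdjoint] at h'
  rw [h']
  exact Finset.sum_nonneg fun i _ => Finset.sum_nonneg fun j _ =>
    mul_nonneg (hp i j) (mul_nonneg (hP.eigenvalues_nonneg i) (hQ.eigenvalues_nonneg j))

theorem posSemidef_one_sub_sq {E : Matrix ι ι ℂ} (hE : E.PosSemidef)
    (hE' : (1 - E).PosSemidef) : (1 - E * E).PosSemidef := by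
  have h : 1 - E * E = (1 - E) + (E * (1 - E) * Eᴴ + (1 - E) * E * (1 - E)ᴴ) := by
    -- `E - E² = E (1 - E) E + (1 - E) E (1 - E)`
    rw [hE.1.eq, hE'.1.eq]
    noncomm_ring
  rw [h]
  exact hE'.add ((hE'.mul_mul_conjTranspose_same E).add (hE.mul_mul_conjTranspose_same (1 - E)))

end Spectral

/-! ### Two scalar inequalities -/

theorem exp_sub_tangent_le (x y : ℝ) :
    Real.exp x - Real.exp y - (x - y) * Real.exp y ≤
      (x - y) ^ 2 * (Real.exp x + Real.exp y) := by
  have hx := Real.exp_pos x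
  have hy := Real.exp_pos y
  -- the tangents of `exp` at `x` and at `y`
  have h1 : Real.exp x - Real.exp y ≤ (x - y) * Real.exp x := by
    have h := mul_le_mul_of_nonneg_left (Real.add_one_le_exp (y - x)) hx.le
    rw [← Real.exp_add, add_sub_cancel] at h
    linarith
  have h2 : (x - y) * Real.exp y ≤ Real.exp x - Real.exp y := by
    have h := mul_le_mul_of_nonneg_left (Real.add_one_le_exp (x - y)) hy.le
    rw [← Real.exp_add, add_sub_cancel] at h
    linarith
  rcases le_total 0 (x - y) with h | h
  · have h3 : (x - y) * Real.exp x - (x - y) * Real.exp y ≤ (x - y) * ((x - y) * Real.exp x) := by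
      rw [← mul_sub]; exact mul_le_mul_of_nonneg_left h1 h
    nlinarith [mul_nonneg (sq_nonneg (x - y)) hy.le]
  · have h3 : (x - y) * Real.exp x - (x - y) * Real.exp y ≤ (x - y) * ((x - y) * Real.exp y) := by
      rw [← mul_sub]; exact mul_le_mul_of_nonpos_left h2 h
    nlinarith [mul_nonneg (sq_nonneg (x - y)) hx.le]

/-- Nonnegativity of the terms of the relative entropy, with the case of equality. At `q = 0` the
value `Real.log 0 = 0` implements `0 log 0 = 0`. -/
theorem entropy_tangent {q w : ℝ} (hq : 0 ≤ q) (hw : 0 < w) :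
    0 ≤ q * Real.log q - q * Real.log w - q + w ∧
      (q * Real.log q - q * Real.log w - q + w = 0 → q = w) := by
  rcases hq.eq_or_lt with rfl | hq
  · exact ⟨by simp [hw.le], fun h => by simpa [eq_comm] using h⟩
  have hlog : Real.log (w / q) = Real.log w - Real.log q := Real.log_div hw.ne' hq.ne'
  have hmul : q * (w / q - 1) = w - q := by field_simp
  constructor
  · have h := mul_le_mul_of_nonneg_left (Real.log_le_sub_one_of_pos (div_pos hw hq)) hq.le
    rw [hlog, hmul] at h
    linarith
  · intro h0
    by_contra hne
    have h := mul_lt_mul_of_pos_left (Real.log_lt_sub_one_of_pos (div_pos hw hq)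
      (fun h => hne ((div_eq_one_iff_eq hq.ne').1 h).symm)) hq
    rw [hlog, hmul] at h
    linarith

/-! ### Gibbs states -/

/-- The partition function `Tr (exp K)`, as a real number. -/
def partition {n : ℕ} (K : Op n) : ℝ := (NormedSpace.exp K).trace.re

/-- The Gibbs state `exp K / Tr (exp K)`. -/
def gibbs {n : ℕ} (K : Op n) : Op n := (partition K)⁻¹ • NormedSpace.exp K

variable {n : ℕ} {K K' E φ : Op n}

theorem expect_comm (E ω : Op n) : expect E ω = expect ω E := by
  rw [expect, expect, Matrix.trace_mul_comm]

theorem expect_add_left (E F ω : Op n) : expect (E + F) ω = expect E ω + expect F ω := by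
  simp [expect, add_mul]

theorem expect_sub_left (E F ω : Op n) : expect (E - F) ω = expect E ω - expect F ω := by
  simp [expect, sub_mul]

theorem expect_smul_left (c : ℝ) (E ω : Op n) : expect (c • E) ω = c * expect E ω := by
  simp [expect]

theorem expect_sum_left {ι : Type*} (s : Finset ι) (f : ι → Op n) (ω : Op n) :
    expect (∑ i ∈ s, f i) ω = ∑ i ∈ s, expect (f i) ω := by
  simp [expect, Finset.sum_mul, Matrix.trace_sum]

theorem expect_one_left (hφ : IsState φ) : expect 1 φ = 1 := by
  simp [expect, hφ.2]

theorem expect_nonneg (hE : IsMeasurement E) (hφ : IsState φ) : 0 ≤ expect E φ :=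
  re_trace_mul_nonneg hE.1 hφ.1

theorem expect_le_one (hE : IsMeasurement E) (hφ : IsState φ) : expect E φ ≤ 1 := by
  have h : 0 ≤ expect (1 - E) φ := re_trace_mul_nonneg hE.2 hφ.1
  rw [expect_sub_left, expect_one_left hφ] at h
  linarith

theorem partition_pos (hK : K.IsHermitian) : 0 < partition K := by
  rw [partition, exp_eq_cfc hK, trace_cfc hK, Complex.ofReal_re]
  exact Finset.sum_pos (fun i _ => Real.exp_pos _) Finset.univ_nonempty

theorem trace_exp (hK : K.IsHermitian) : (NormedSpace.exp K).trace = (partition K : ℂ) := by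
  rw [partition, exp_eq_cfc hK, trace_cfc hK, Complex.ofReal_re]

theorem gibbs_eq_cfc (hK : K.IsHermitian) :
    gibbs K = cfc (fun x => Real.exp (x - Real.log (partition K))) K := by
  have hZ := partition_pos hK
  rw [gibbs, exp_eq_cfc hK, ← cfc_smul _ _ _ (continuousOn_spectrum K _)]
  refine cfc_congr fun x _ => ?_
  rw [Real.exp_sub, Real.exp_log hZ, smul_eq_mul]
  field_simp

theorem isState_gibbs (hK : K.IsHermitian) : IsState (gibbs K) := by
  constructor
  · rw [gibbs_eq_cfc hK]
    exact posSemidef_cfc hK fun x => (Real.exp_pos _).le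
  · rw [gibbs, Matrix.trace_smul, trace_exp hK, Complex.real_smul, ← Complex.ofReal_mul,
      inv_mul_cancel₀ (partition_pos hK).ne', Complex.ofReal_one]

theorem matLog_gibbs (hK : K.IsHermitian) :
    matLog (gibbs K) = K - Real.log (partition K) • (1 : Op n) := by
  have hK' : IsSelfAdjoint K := hK
  rw [matLog, gibbs_eq_cfc hK, ← cfc_comp' _ _ K
    (K.finite_real_spectrum.image _ |>.continuousOn _) (continuousOn_spectrum K _)]
  simp only [Real.log_exp]
  rw [cfc_sub _ _ K (continuousOn_spectrum K _) (continuousOn_spectrum K _), cfc_id' ℝ K,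
    cfc_const _ K, Algebra.algebraMap_eq_smul_one]

theorem partition_zero (n : ℕ) : partition (0 : Op n) = 2 ^ n := by
  simp [partition]
  norm_cast

theorem gibbs_zero (n : ℕ) : gibbs (0 : Op n) = mixed n := by
  rw [gibbs, partition_zero, NormedSpace.exp_zero, mixed]

theorem exp_sub_smul_one (hK : K.IsHermitian) (c : ℝ) :
    NormedSpace.exp (K - c • (1 : Op n)) = Real.exp (-c) • NormedSpace.exp K := by
  have hK' : IsSelfAdjoint K := hK
  have h : K - c • (1 : Op n) = cfc (fun x => x - c) K := by
    rw [cfc_sub _ _ K (continuousOn_spectrum K _) (continuousOn_spectrum K _), cfc_id' ℝ K,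
      cfc_const _ K, Algebra.algebraMap_eq_smul_one]
  have hh : (cfc (fun x : ℝ => x - c) K).IsHermitian := isHermitian_cfc _ K
  rw [h, exp_eq_cfc hh, exp_eq_cfc hK, ← cfc_comp' _ _ K
    (K.finite_real_spectrum.image _ |>.continuousOn _) (continuousOn_spectrum K _),
    ← cfc_smul _ _ _ (continuousOn_spectrum K _)]
  refine cfc_congr fun x _ => ?_
  rw [smul_eq_mul, ← Real.exp_add]
  ring_nf

theorem gibbs_sub_smul_one (hK : K.IsHermitian) (c : ℝ) :
    gibbs (K - c • (1 : Op n)) = gibbs K := by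
  have h : partition (K - c • (1 : Op n)) = Real.exp (-c) * partition K := by
    rw [partition, exp_sub_smul_one hK, Matrix.trace_smul, Complex.smul_re, smul_eq_mul,
      partition]
  rw [gibbs, gibbs, h, exp_sub_smul_one hK, smul_smul, mul_inv_rev, mul_assoc,
    inv_mul_cancel₀ (Real.exp_pos _).ne', mul_one]

theorem megUpdate_gibbs (hK : K.IsHermitian) (hE : E.IsHermitian) (η : ℝ) :
    megUpdate (gibbs K) E η = gibbs (K - η • E) := by
  have hKE : (K - η • E).IsHermitian := hK.sub (hE.smul (IsSelfAdjoint.all η))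
  have h : matLog (gibbs K) - η • E = (K - η • E) - Real.log (partition K) • (1 : Op n) := by
    rw [matLog_gibbs hK]; abel
  have hH : (matLog (gibbs K) - η • E).IsHermitian :=
    (isHermitian_cfc _ _).sub (hE.smul (IsSelfAdjoint.all η))
  rw [← gibbs_sub_smul_one hKE (Real.log (partition K)), ← h, megUpdate, trace_exp hH,
    ← Complex.ofReal_inv, Complex.coe_smul]
  rfl

/-- The Gibbs variational principle, with uniqueness of the maximizer. -/
theorem gibbs_variational (hK : K.IsHermitian) (hφ : IsState φ) :
    expect K φ - expect φ (matLog φ) ≤ Real.log (partition K) ∧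
      (expect K φ - expect φ (matLog φ) = Real.log (partition K) → φ = gibbs K) := by
  obtain ⟨p, hp, h⟩ := exists_trace_cfc_mul_cfc hφ.1.1 hK
  have hφ' : IsSelfAdjoint φ := hφ.1.1
  have hK' : IsSelfAdjoint K := hK
  set L := Real.log (partition K)
  set q := hφ.1.1.eigenvalues
  set k := hK.eigenvalues
  have hg := isState_gibbs hK
  have hent : expect φ (matLog φ) = ∑ i, ∑ j, p i j * (q i * Real.log (q i)) := by
    have := h (fun x => x * Real.log x) (fun _ => 1)
    rw [cfc_const_one ℝ K, mul_one, cfc_mul _ _ φ (continuousOn_spectrum φ _)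
      (continuousOn_spectrum φ _), cfc_id' ℝ φ] at this
    simpa [expect, matLog] using this
  have hexp : expect K φ = ∑ i, ∑ j, p i j * (q i * k j) := by
    have := h (fun x => x) (fun x => x)
    rwa [cfc_id' ℝ φ, cfc_id' ℝ K, ← expect, expect_comm] at this
  have hone : 1 = ∑ i, ∑ j, p i j * q i := by
    have := h (fun x => x) (fun _ => 1)
    rw [cfc_id' ℝ φ, cfc_const_one ℝ K, mul_one, hφ.2] at this
    simpa using this
  have hgib : 1 = ∑ i, ∑ j, p i j * Real.exp (k j - L) := by
    have := h (fun _ => 1) (fun x => Real.exp (x - L))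
    rw [cfc_const_one ℝ φ, one_mul, ← gibbs_eq_cfc hK, hg.2] at this
    simpa using this
  have hsq : expect (φ - gibbs K) (φ - gibbs K) =
      ∑ i, ∑ j, p i j * (q i - Real.exp (k j - L)) ^ 2 := by
    have h1 := h (fun x => x * x) (fun _ => 1)
    have h2 := h (fun x => x) (fun x => Real.exp (x - L))
    have h3 := h (fun _ => 1) (fun x => Real.exp (x - L) * Real.exp (x - L))
    rw [cfc_mul _ _ φ (continuousOn_spectrum φ _) (continuousOn_spectrum φ _), cfc_id' ℝ φ,
      cfc_const_one ℝ K, mul_one] at h1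
    rw [cfc_id' ℝ φ, ← gibbs_eq_cfc hK] at h2
    rw [cfc_mul _ _ K (continuousOn_spectrum K _) (continuousOn_spectrum K _),
      cfc_const_one ℝ φ, one_mul, ← gibbs_eq_cfc hK] at h3
    have h4 : expect (φ - gibbs K) (φ - gibbs K) =
        (φ * φ).trace.re - 2 * (φ * gibbs K).trace.re + (gibbs K * gibbs K).trace.re := by
      have := congrArg Complex.re (Matrix.trace_mul_comm (gibbs K) φ)
      simp only [expect, sub_mul, mul_sub, Matrix.trace_sub, Complex.sub_re]
      linarith
    rw [h4, h1, h2, h3]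
    simp only [Finset.mul_sum, ← Finset.sum_sub_distrib, ← Finset.sum_add_distrib]
    refine Finset.sum_congr rfl fun i _ => Finset.sum_congr rfl fun j _ => ?_
    ring
  -- the relative entropy of `φ` with respect to `gibbs K`, in the two eigenbases
  have hD : expect φ (matLog φ) - expect K φ + L =
      ∑ i, ∑ j, p i j * (q i * Real.log (q i) - q i * Real.log (Real.exp (k j - L)) - q i +
        Real.exp (k j - L)) := by
    have hL : L = L * (∑ i, ∑ j, p i j * q i) - (∑ i, ∑ j, p i j * q i) +
        ∑ i, ∑ j, p i j * Real.exp (k j - L) := by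
      rw [← hone, ← hgib]; ring
    rw [hent, hexp]
    nth_rewrite 1 [hL]
    simp only [Real.log_exp, Finset.mul_sum, ← Finset.sum_sub_distrib, ← Finset.sum_add_distrib]
    refine Finset.sum_congr rfl fun i _ => Finset.sum_congr rfl fun j _ => ?_
    ring
  have hq : ∀ i, 0 ≤ q i := hφ.1.eigenvalues_nonneg
  have hterm : ∀ i j, 0 ≤ p i j * (q i * Real.log (q i) - q i * Real.log (Real.exp (k j - L)) -
      q i + Real.exp (k j - L)) := fun i j =>
    mul_nonneg (hp i j) (entropy_tangent (hq i) (Real.exp_pos _)).1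
  constructor
  · have := Finset.sum_nonneg fun i (_ : i ∈ Finset.univ) =>
      Finset.sum_nonneg fun j (_ : j ∈ Finset.univ) => hterm i j
    rw [← hD] at this
    linarith
  · intro h0
    have hzero : ∑ i, ∑ j, p i j * (q i * Real.log (q i) -
        q i * Real.log (Real.exp (k j - L)) - q i + Real.exp (k j - L)) = 0 := by
      rw [← hD]; linarith
    have hpt : ∀ i j, p i j * (q i - Real.exp (k j - L)) ^ 2 = 0 := by
      intro i j
      have h1 := (Finset.sum_eq_zero_iff_of_nonneg
        fun i _ => Finset.sum_nonneg fun j _ => hterm i j).1 hzero i (Finset.mem_univ i)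
      have h2 := (Finset.sum_eq_zero_iff_of_nonneg fun j _ => hterm i j).1 h1 j (Finset.mem_univ j)
      rcases mul_eq_zero.1 h2 with h3 | h3
      · rw [h3, zero_mul]
      · rw [(entropy_tangent (hq i) (Real.exp_pos _)).2 h3]; ring
    -- so the squared Hilbert-Schmidt distance of `φ` and `gibbs K` vanishes
    have hnorm : expect (φ - gibbs K) (φ - gibbs K) = 0 := by
      rw [hsq]; simp [hpt]
    have hherm : (φ - gibbs K).IsHermitian := hφ.1.1.sub hg.1.1
    have hpsd := Matrix.posSemidef_conjTranspose_mul_self (φ - gibbs K)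
    have him := (Complex.nonneg_iff.1 hpsd.trace_nonneg).2
    rw [hherm.eq] at him
    refine sub_eq_zero.1 (Matrix.trace_conjTranspose_mul_self_eq_zero_iff.1 ?_)
    rw [hherm.eq]
    exact Complex.ext hnorm him.symm

theorem gibbs_variational_eq (hK : K.IsHermitian) :
    expect K (gibbs K) - expect (gibbs K) (matLog (gibbs K)) = Real.log (partition K) := by
  rw [matLog_gibbs hK, expect_comm (gibbs K), expect_sub_left, expect_smul_left,
    expect_one_left (isState_gibbs hK)]
  ring

theorem expect_matLog_nonpos (hφ : IsState φ) : expect φ (matLog φ) ≤ 0 := by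
  have hφ' : IsSelfAdjoint φ := hφ.1.1
  have h := trace_cfc hφ.1.1 (fun x => x * Real.log x)
  have h1 := trace_cfc hφ.1.1 (fun x => x)
  rw [cfc_mul _ _ φ (continuousOn_spectrum φ _) (continuousOn_spectrum φ _), cfc_id' ℝ φ] at h
  rw [cfc_id' ℝ φ] at h1
  have hsum : ∑ i, hφ.1.1.eigenvalues i = 1 := by exact_mod_cast h1.symm.trans hφ.2
  rw [expect, matLog, h, Complex.ofReal_re]
  refine Finset.sum_nonpos fun i _ => ?_
  have hi := hφ.1.eigenvalues_nonneg i
  exact mul_nonpos_of_nonneg_of_nonpos hi (Real.log_nonpos hi (hsum ▸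
    Finset.single_le_sum (fun j _ => hφ.1.eigenvalues_nonneg j) (Finset.mem_univ i)))

theorem expect_le_log_partition (hK : K.IsHermitian) (hφ : IsState φ) :
    expect K φ ≤ Real.log (partition K) := by
  linarith [(gibbs_variational hK hφ).1, expect_matLog_nonpos hφ]

/-- Second order bound for `Tr exp`. It takes the place of the Golden-Thompson inequality in the
analysis of the updates. -/
theorem partition_sub_tangent_le (hK : K.IsHermitian) (hK' : K'.IsHermitian) :
    partition K' - partition K - expect (K' - K) (NormedSpace.exp K) ≤
      expect ((K' - K) * (K' - K)) (NormedSpace.exp K' + NormedSpace.exp K) := by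
  have sK : IsSelfAdjoint K := hK
  have sK' : IsSelfAdjoint K' := hK'
  obtain ⟨p, hp, h⟩ := exists_trace_cfc_mul_cfc hK' hK
  set x := hK'.eigenvalues
  set y := hK.eigenvalues
  have c := fun f : ℝ → ℝ => continuousOn_spectrum K f
  have c' := fun f : ℝ → ℝ => continuousOn_spectrum K' f
  have h1 := h Real.exp (fun _ => 1)
  have h2 := h (fun _ => 1) Real.exp
  have h3 := h (fun x => x) Real.exp
  have h4 := h (fun _ => 1) (fun x => x * Real.exp x)
  have h5 := h (fun x => x * x * Real.exp x) (fun _ => 1)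
  have h6 := h (fun x => x * Real.exp x) (fun x => x)
  have h7 := h Real.exp (fun x => x * x)
  have h8 := h (fun x => x * x) Real.exp
  have h9 := h (fun x => x) (fun x => x * Real.exp x)
  have h10 := h (fun _ => 1) (fun x => x * x * Real.exp x)
  simp only [cfc_mul _ _ K (c _) (c _), cfc_mul _ _ K' (c' _) (c' _), cfc_id' ℝ K, cfc_id' ℝ K',
    cfc_const_one ℝ K, cfc_const_one ℝ K', mul_one, one_mul, ← exp_eq_cfc hK, ← exp_eq_cfc hK']
    at h1 h2 h3 h4 h5 h6 h7 h8 h9 h10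
  have comm : K * NormedSpace.exp K = NormedSpace.exp K * K := by
    rw [exp_eq_cfc hK]
    exact ((Commute.refl K).cfc_real Real.exp).eq.symm
  have comm' : K' * NormedSpace.exp K' = NormedSpace.exp K' * K' := by
    rw [exp_eq_cfc hK']
    exact ((Commute.refl K').cfc_real Real.exp).eq.symm
  have hl : partition K' - partition K - expect (K' - K) (NormedSpace.exp K) =
      ∑ i, ∑ j, p i j * (Real.exp (x i) - Real.exp (y j) - (x i - y j) * Real.exp (y j)) := by
    simp only [partition, expect, sub_mul, Matrix.trace_sub, Complex.sub_re]
    rw [h1, h2, h3, h4]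
    simp only [← Finset.sum_sub_distrib]
    refine Finset.sum_congr rfl fun i _ => Finset.sum_congr rfl fun j _ => ?_
    ring
  have hr : expect ((K' - K) * (K' - K)) (NormedSpace.exp K' + NormedSpace.exp K) =
      ∑ i, ∑ j, p i j * ((x i - y j) ^ 2 * (Real.exp (x i) + Real.exp (y j))) := by
    have e1 : (K' * K * NormedSpace.exp K').trace = (K' * NormedSpace.exp K' * K).trace := by
      rw [Matrix.trace_mul_comm, ← mul_assoc, comm']
    have e2 : (K * K' * NormedSpace.exp K').trace = (K' * NormedSpace.exp K' * K).trace := by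
      rw [mul_assoc, Matrix.trace_mul_comm]
    have e3 : (K * K * NormedSpace.exp K').trace = (NormedSpace.exp K' * (K * K)).trace :=
      Matrix.trace_mul_comm _ _
    have e4 : (K * K' * NormedSpace.exp K).trace = (K' * (K * NormedSpace.exp K)).trace := by
      rw [mul_assoc, Matrix.trace_mul_comm, mul_assoc, comm]
    have e5 : (K' * K * NormedSpace.exp K).trace = (K' * (K * NormedSpace.exp K)).trace := by
      rw [mul_assoc]
    simp only [expect, sub_mul, mul_sub, mul_add, Matrix.trace_add, Matrix.trace_sub,
      Complex.sub_re, Complex.add_re, e1, e2, e3, e4, e5]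
    rw [h5, h6, h7, h8, h9, h10]
    simp only [← Finset.sum_sub_distrib, ← Finset.sum_add_distrib]
    refine Finset.sum_congr rfl fun i _ => Finset.sum_congr rfl fun j _ => ?_
    ring
  rw [hl, hr]
  exact Finset.sum_le_sum fun i _ => Finset.sum_le_sum fun j _ =>
    mul_le_mul_of_nonneg_left (exp_sub_tangent_le _ _) (hp i j)

theorem posSemidef_exp (hK : K.IsHermitian) : (NormedSpace.exp K).PosSemidef := by
  rw [exp_eq_cfc hK]
  exact posSemidef_cfc hK fun x => (Real.exp_pos x).le

theorem expect_exp (hK : K.IsHermitian) (A : Op n) :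
    expect A (NormedSpace.exp K) = partition K * expect A (gibbs K) := by
  have hZ := partition_pos hK
  rw [expect_comm A (gibbs K), gibbs, expect_smul_left, expect_comm, mul_inv_cancel_left₀ hZ.ne']

/-- Smoothness of the free energy `log (Tr (exp K))` in the direction of a measurement, independently
of the dimension. -/
theorem log_partition_add_smul_le (hK : K.IsHermitian) (hE : IsMeasurement E) (s : ℝ) :
    Real.log (partition (K + s • E)) ≤
      Real.log (partition K) + s * expect E (gibbs K) + 3 * s ^ 2 := by
  have hK' : (K + s • E).IsHermitian := hK.add (hE.1.1.smul (IsSelfAdjoint.all s))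
  have hz0 := expect_nonneg hE (isState_gibbs hK)
  have hz1 := expect_le_one hE (isState_gibbs hK)
  set z := expect E (gibbs K)
  have hZ := partition_pos hK
  have hZ' := partition_pos hK'
  rcases le_or_gt (1 / 4) (s ^ 2) with hs | hs
  · -- for `s ^ 2 ≥ 1 / 4`, the first order bound `max s 0` on the increase is enough, as it is at
    -- most `s * z + 3 * s ^ 2`
    have hv := (gibbs_variational hK (isState_gibbs hK')).1
    have hv' := gibbs_variational_eq hK'
    have h0 := expect_nonneg hE (isState_gibbs hK')
    have h1 := expect_le_one hE (isState_gibbs hK')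
    rw [expect_add_left, expect_smul_left] at hv'
    rcases le_total 0 s with h | h
    · have h2 : 1 / 2 ≤ s := by nlinarith
      nlinarith [mul_le_mul_of_nonneg_left h1 h, mul_nonneg h hz0]
    · have h2 : s ≤ -1 / 2 := by nlinarith
      nlinarith [mul_le_mul_of_nonpos_left hz1 h, mul_nonpos_of_nonpos_of_nonneg h h0]
  · have ht := partition_sub_tangent_le hK hK'
    have hsq : expect ((s • E) * (s • E)) (NormedSpace.exp (K + s • E) + NormedSpace.exp K) ≤
        s ^ 2 * (partition (K + s • E) + partition K) := by
      have h : 0 ≤ expect (1 - E * E) (NormedSpace.exp (K + s • E) + NormedSpace.exp K) :=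
        re_trace_mul_nonneg (posSemidef_one_sub_sq hE.1 hE.2)
          ((posSemidef_exp hK').add (posSemidef_exp hK))
      have h1 : expect 1 (NormedSpace.exp (K + s • E) + NormedSpace.exp K) =
          partition (K + s • E) + partition K := by
        simp [expect, partition]
      rw [expect_sub_left, h1] at h
      rw [smul_mul_smul_comm, expect_smul_left, ← sq]
      exact mul_le_mul_of_nonneg_left (by linarith) (sq_nonneg s)
    rw [add_sub_cancel_left, expect_smul_left, expect_exp hK] at ht
    have hpos : 0 < 1 - s ^ 2 := by linarith
    have hmul : partition (K + s • E) * (1 - s ^ 2) ≤ partition K * (1 + (s * z + s ^ 2)) := by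
      linarith
    have hright : 0 < 1 + (s * z + s ^ 2) := by
      by_contra hcon
      linarith [mul_pos hZ' hpos, mul_nonpos_of_nonneg_of_nonpos hZ.le (not_lt.1 hcon)]
    have hlog := Real.log_le_log (mul_pos hZ' hpos) hmul
    rw [Real.log_mul hZ'.ne' hpos.ne', Real.log_mul hZ.ne' hright.ne'] at hlog
    have hl1 := Real.log_le_sub_one_of_pos hright
    have hl2 := Real.one_sub_inv_le_log_of_pos hpos
    have hl3 : (1 - s ^ 2)⁻¹ ≤ 1 + 2 * s ^ 2 := by
      rw [inv_le_iff_one_le_mul₀ hpos]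
      nlinarith [sq_nonneg s]
    linarith

/-! ### Losses and gradients -/

theorem Round.isHermitian_grad {r : Round n} (hr : IsMeasurement r.E) : r.grad.IsHermitian :=
  hr.1.1.smul (IsSelfAdjoint.all _)

theorem Round.loss_nonneg (r : Round n) : 0 ≤ r.loss := sq_nonneg _

theorem Round.loss_le {r : Round n} {B : ℝ} (hE : IsMeasurement r.E) (hω : IsState r.ω)
    (hb : |r.b| ≤ B) : r.loss ≤ (1 + |B|) ^ 2 := by
  have h0 := expect_nonneg hE hω
  have h1 := expect_le_one hE hω
  have hb' := abs_le.1 (hb.trans (le_abs_self B))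
  exact sq_le_sq' (by linarith) (by linarith)

/-- Convexity of the squared loss. -/
theorem Round.loss_sub_lossOf_le (r : Round n) (φ : Op n) :
    r.loss - r.lossOf φ ≤ expect r.grad r.ω - expect r.grad φ := by
  simp only [Round.loss, Round.lossOf, Round.grad, expect_smul_left]
  linarith [sq_nonneg (expect r.E r.ω - expect r.E φ)]

/-! ### Predictions and runs of the doubling trick -/

theorem block_snd_le (x : ℕ → Round n) (t : ℕ) : (block x t).2 ≤ t := by
  induction t with
  | zero => simp [block]
  | succ t ih =>
    rw [block]
    split_ifs
    · exact le_rfl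
    · exact ih.trans t.le_succ

theorem block_congr {x y : ℕ → Round n} {t : ℕ} (h : ∀ s < t, x s = y s) :
    block x t = block y t := by
  induction t with
  | zero => rfl
  | succ t ih =>
    have ih' := ih fun s hs => h s (hs.trans t.lt_succ_self)
    have hsum : ∑ s ∈ Finset.Icc (block y t).2 t, (x s).loss =
        ∑ s ∈ Finset.Icc (block y t).2 t, (y s).loss :=
      Finset.sum_congr rfl fun s hs => by
        rw [h s (Nat.lt_succ_of_le (Finset.mem_Icc.1 hs).2)]
    rw [block, block, ih', hsum]

theorem rate_pos (hn : 1 ≤ n) (β : ℕ) : 0 < rate n β := by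
  have : (0 : ℝ) < n := by exact_mod_cast hn
  have := Real.log_pos one_lt_two
  exact lt_min (Real.sqrt_pos.2 (by positivity)) (by norm_num)

/-- The exponent `-η ∑ ∇ₛ`, summed over the rounds `s` of the current block that precede `t`. -/
def exponent (x : ℕ → Round n) (t : ℕ) : Op n :=
  (-rate n (block x t).1) • ∑ s ∈ Finset.Ico (block x t).2 t, (x s).grad

theorem exponent_congr {x y : ℕ → Round n} {t : ℕ} (h : ∀ s < t, x s = y s) :
    exponent x t = exponent y t := by
  rw [exponent, exponent, block_congr h]
  congr 1
  exact Finset.sum_congr rfl fun s hs => by rw [h s (Finset.mem_Ico.1 hs).2]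

theorem isHermitian_sum_grad {x : ℕ → Round n} {t : ℕ} (hE : ∀ s < t, IsMeasurement (x s).E)
    (c : ℝ) (a : ℕ) : (c • ∑ s ∈ Finset.Ico a t, (x s).grad).IsHermitian := by
  have h : IsSelfAdjoint (∑ s ∈ Finset.Ico a t, (x s).grad) :=
    isSelfAdjoint_sum _ fun s hs => Round.isHermitian_grad (hE s (Finset.mem_Ico.1 hs).2)
  exact Matrix.IsHermitian.smul h (IsSelfAdjoint.all c)

theorem isHermitian_exponent {x : ℕ → Round n} {t : ℕ} (hE : ∀ s < t, IsMeasurement (x s).E) :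
    (exponent x t).IsHermitian :=
  isHermitian_sum_grad hE _ _

/-- Both methods predict the Gibbs state of `exponent x t`: for MEG the normalizations cancel and
the exponents telescope from `log (mixed n)`, for RFTL it is the unique minimizer by the variational
principle. -/
theorem isPrediction_iff (u : Update) {x : ℕ → Round n} {t : ℕ}
    (hE : ∀ s < t, IsMeasurement (x s).E) (hω : ∀ s < t, (x s).ω = gibbs (exponent x s))
    (ω : Op n) : IsPrediction u x t ω ↔ ω = gibbs (exponent x t) := by
  have hH : (exponent x t).IsHermitian := isHermitian_exponent hE
  rw [IsPrediction.eq_def]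
  split_ifs with ht
  · rw [exponent, ← ht, Finset.Ico_self, Finset.sum_empty, smul_zero, gibbs_zero]
  cases u with
  | MEG =>
    obtain ⟨r, rfl⟩ : ∃ r, t = r + 1 :=
      Nat.exists_eq_succ_of_ne_zero fun h => ht (by subst h; rfl)
    have hb : block x (r + 1) = block x r := by
      rw [block] at ht ⊢
      split_ifs at ht ⊢
      · exact absurd rfl ht
      · rfl
    have hstep : exponent x (r + 1) = exponent x r - rate n (block x r).1 • (x r).grad := by
      rw [exponent, exponent, hb, Finset.sum_Ico_succ_top (block_snd_le x r), smul_add, neg_smul,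
        neg_smul, ← sub_eq_add_neg]
    have hr : r < r + 1 := r.lt_succ_self
    simp only [Nat.add_sub_cancel]
    rw [hω r hr, hb, hstep, megUpdate_gibbs
      (isHermitian_exponent fun s hs => hE s (hs.trans hr)) (Round.isHermitian_grad (hE r hr))]
  | RFTL =>
    have hobj : ∀ φ, rftlObjective x (block x t).2 t (rate n (block x t).1) φ =
        -(expect (exponent x t) φ - expect φ (matLog φ)) := fun φ => by
      rw [rftlObjective, exponent, expect_smul_left, expect_sum_left]
      ring
    have hgv := gibbs_variational_eq hH
    simp only
    constructor
    · rintro ⟨hs, hmin⟩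
      have h1 := hmin (isState_gibbs hH)
      simp only [Set.mem_ofPred_eq, hobj] at h1
      have h2 := gibbs_variational hH hs
      exact h2.2 (le_antisymm h2.1 (by linarith))
    · rintro rfl
      refine ⟨isState_gibbs hH, fun φ hφ => ?_⟩
      simp only [Set.mem_ofPred_eq, hobj]
      linarith [(gibbs_variational hH hφ).1]

/-- The round in which the learner predicts the Gibbs state of the current exponent and the
adversary `A` answers. -/
def nextRound (A : Adversary n) (x : ℕ → Round n) (t : ℕ) : Round n where
  ω := gibbs (exponent x t)
  E := A.meas t (fun s => x s) (gibbs (exponent x t))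
  b := A.target t (fun s => x s) (gibbs (exponent x t))

/-- The first `t` rounds of the game against `A`, continued by a dummy round. -/
def history (A : Adversary n) : ℕ → ℕ → Round n
  | 0 => fun _ => ⟨0, 0, 0⟩
  | t + 1 => Function.update (history A t) t (nextRound A (history A t) t)

theorem history_eq (A : Adversary n) {s t : ℕ} (h : s < t) :
    history A t s = history A (s + 1) s := by
  induction t, h using Nat.le_induction with
  | base => rfl
  | succ t h ih =>
    rw [history, Function.update_of_ne (Nat.ne_of_lt h), ih]

theorem exists_isRun (u : Update) (A : Adversary n) (T : ℕ) :
    ∃ x : ℕ → Round n, IsRun u A T x := by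
  set x : ℕ → Round n := fun s => history A (s + 1) s with hx
  have hstep : ∀ t, x t = nextRound A x t := fun t => by
    have hh : ∀ s < t, history A t s = x s := fun s hs => history_eq A hs
    have hp : (fun s : Fin t => history A t s) = fun s : Fin t => x s :=
      funext fun s => hh s s.2
    have h0 : x t = nextRound A (history A t) t := by
      simp [hx, history]
    rw [h0, nextRound, nextRound, exponent_congr hh, hp]
  have hE : ∀ t, IsMeasurement (x t).E := fun t => by
    rw [hstep t]; exact A.isMeasurement _ _ _
  have hω : ∀ t, (x t).ω = gibbs (exponent x t) := fun t => by
    conv_lhs => rw [hstep t, nextRound]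
  refine ⟨x, fun t _ => ?_, fun t _ => ?_, fun t _ => ?_⟩
  · exact (isPrediction_iff u (fun s _ => hE s) (fun s _ => hω s) _).2 (hω t)
  · rw [hω t]; conv_lhs => rw [hstep t, nextRound]
  · rw [hω t]; conv_lhs => rw [hstep t, nextRound]

theorem IsRun.isMeasurement {u : Update} {A : Adversary n} {T : ℕ} {x : ℕ → Round n}
    (hx : IsRun u A T x) {t : ℕ} (ht : t < T) : IsMeasurement (x t).E := by
  rw [hx.meas t ht]
  exact A.isMeasurement _ _ _

theorem IsRun.eq_gibbs {u : Update} {A : Adversary n} {T : ℕ} {x : ℕ → Round n}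
    (hx : IsRun u A T x) {t : ℕ} (ht : t < T) : (x t).ω = gibbs (exponent x t) := by
  induction t using Nat.strong_induction_on with
  | _ t ih =>
    exact (isPrediction_iff u (fun s hs => hx.isMeasurement (hs.trans ht))
      (fun s hs => ih s hs (hs.trans ht)) _).1 (hx.predict t ht)

theorem IsRun.loss_le {u : Update} {A : Adversary n} {T : ℕ} {x : ℕ → Round n} {B : ℝ}
    (hA : ∀ t past ω, |A.target t past ω| ≤ B) (hx : IsRun u A T x) {t : ℕ} (ht : t < T) :
    (x t).loss ≤ (1 + |B|) ^ 2 := by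
  refine Round.loss_le (hx.isMeasurement ht) ?_ ?_
  · rw [hx.eq_gibbs ht]
    exact isState_gibbs (isHermitian_exponent fun s hs => hx.isMeasurement (hs.trans ht))
  · rw [hx.target t ht]
    exact hA _ _ _

/-! ### Regret inside a block -/

/-- The learner's linearized losses drive down the free energy of the exponent. This uses
`‖∇ₛ‖² ≤ 4 ℓₛ`, so that the quadratic error is paid for by the losses themselves, and not by the
number of rounds. -/
theorem log_partition_sum_grad_le {x : ℕ → Round n} {η : ℝ} {a t : ℕ} (hat : a ≤ t)
    (hE : ∀ s < t, IsMeasurement (x s).E)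
    (hω : ∀ s < t, a ≤ s → (x s).ω = gibbs ((-η) • ∑ r ∈ Finset.Ico a s, (x r).grad)) :
    Real.log (partition ((-η) • ∑ s ∈ Finset.Ico a t, (x s).grad)) ≤
      n * Real.log 2 - η * ∑ s ∈ Finset.Ico a t, expect (x s).grad (x s).ω +
        12 * η ^ 2 * ∑ s ∈ Finset.Ico a t, (x s).loss := by
  induction t, hat using Nat.le_induction with
  | base => simp [partition_zero]
  | succ t hat ih =>
    have ht := t.lt_succ_self
    have hEt : ∀ s < t, IsMeasurement (x s).E := fun s hs => hE s (hs.trans ht)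
    have ih' := ih hEt fun s hs => hω s (hs.trans ht)
    have hstep := log_partition_add_smul_le (isHermitian_sum_grad hEt (-η) a) (hE t ht)
      (-η * (2 * (expect (x t).E (x t).ω - (x t).b)))
    rw [← hω t ht hat, mul_smul, ← Round.grad, ← smul_add] at hstep
    rw [Finset.sum_Ico_succ_top hat, Finset.sum_Ico_succ_top hat, Finset.sum_Ico_succ_top hat]
    have hgrad : expect (x t).grad (x t).ω =
        2 * (expect (x t).E (x t).ω - (x t).b) * expect (x t).E (x t).ω := by
      rw [Round.grad, expect_smul_left]
    have hloss : (x t).loss = (expect (x t).E (x t).ω - (x t).b) ^ 2 := rfl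
    rw [hgrad, hloss]
    linarith

/-- Small-loss regret bound for Gibbs predictions with a fixed learning rate `η`. -/
theorem sum_loss_sub_lossOf_le {x : ℕ → Round n} {η : ℝ} (hη : 0 < η) {a t : ℕ} (hat : a ≤ t)
    (hE : ∀ s < t, IsMeasurement (x s).E)
    (hω : ∀ s < t, a ≤ s → (x s).ω = gibbs ((-η) • ∑ r ∈ Finset.Ico a s, (x r).grad))
    {φ : Op n} (hφ : IsState φ) :
    ∑ s ∈ Finset.Ico a t, ((x s).loss - (x s).lossOf φ) ≤
      n * Real.log 2 / η + 12 * η * ∑ s ∈ Finset.Ico a t, (x s).loss := by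
  have h1 := log_partition_sum_grad_le hat hE hω
  have h2 := expect_le_log_partition (isHermitian_sum_grad hE (-η) a) hφ
  rw [expect_smul_left, expect_sum_left] at h2
  have h3 : ∑ s ∈ Finset.Ico a t, ((x s).loss - (x s).lossOf φ) ≤
      ∑ s ∈ Finset.Ico a t, (expect (x s).grad (x s).ω - expect (x s).grad φ) :=
    Finset.sum_le_sum fun s _ => (x s).loss_sub_lossOf_le φ
  rw [Finset.sum_sub_distrib (f := fun s => expect (x s).grad (x s).ω)] at h3
  have h4 : n * Real.log 2 / η + 12 * η * ∑ s ∈ Finset.Ico a t, (x s).loss =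
      (n * Real.log 2 + 12 * η ^ 2 * ∑ s ∈ Finset.Ico a t, (x s).loss) / η := by
    field_simp
  rw [h4, le_div_iff₀ hη]
  linarith [mul_le_mul_of_nonneg_right h3 hη.le]

/-- With the rate of block `β`, the fixed-rate bound is of order `√(n 2 ^ β) + n` as long as the loss
`S` in the block exceeds `2 ^ β` by at most a constant. -/
theorem rate_tradeoff (hn : 1 ≤ n) (β : ℕ) {M S : ℝ} (hM : 0 ≤ M) (hS : S ≤ 2 ^ β + M) :
    n * Real.log 2 / rate n β + 12 * rate n β * S ≤
      (24 * (M + 1) + 2) * (√n * √(2 ^ β) + n) := by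
  have hn' : (1 : ℝ) ≤ n := by exact_mod_cast hn
  have hl0 := Real.log_pos one_lt_two
  have hl1 : Real.log 2 ≤ 1 := by linarith [Real.log_two_lt_d9]
  have hp : (1 : ℝ) ≤ 2 ^ β := one_le_pow₀ (by norm_num)
  have hη := rate_pos hn β
  set u : ℝ := n * Real.log 2 with hu
  set v : ℝ := 2 ^ β + 1 with hv
  have hu0 : 0 < u := by positivity
  have hun : u ≤ n := mul_le_of_le_one_right (by linarith) hl1
  have hv0 : 0 < v := by positivity
  have hr : 0 < √(u / v) := Real.sqrt_pos.2 (by positivity)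
  have hrv : √(u / v) * v = √(u * v) := by
    rw [Real.sqrt_div hu0.le, Real.sqrt_mul hu0.le]
    nth_rewrite 2 [← Real.mul_self_sqrt hv0.le]
    have := Real.sqrt_pos.2 hv0
    field_simp
  have hur : u / √(u / v) = √(u * v) := by
    rw [div_eq_iff hr.ne', ← Real.sqrt_mul (by positivity),
      show u * v * (u / v) = u * u by field_simp, Real.sqrt_mul_self hu0.le]
  have hdiv : u / rate n β ≤ √(u * v) + 2 * u := by
    rcases min_choice √(u / v) (1 / 2) with h | h
    · rw [rate, ← hu, ← hv, h, hur]; linarith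
    · rw [rate, ← hu, ← hv, h]
      linarith [Real.sqrt_nonneg (u * v)]
  have hmul : rate n β * S ≤ (M + 1) * √(u * v) := by
    have hSv : S ≤ (M + 1) * v := by nlinarith
    calc rate n β * S ≤ rate n β * ((M + 1) * v) := mul_le_mul_of_nonneg_left hSv hη.le
      _ ≤ √(u / v) * ((M + 1) * v) :=
          mul_le_mul_of_nonneg_right (min_le_left _ _) (by positivity)
      _ = (M + 1) * √(u * v) := by rw [← hrv]; ring
  have huv : √(u * v) ≤ 2 * (√n * √(2 ^ β)) := by
    refine Real.sqrt_le_left (by positivity) |>.2 ?_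
    rw [mul_pow, mul_pow, Real.sq_sqrt (by linarith), Real.sq_sqrt (by linarith)]
    nlinarith
  have hw : 0 ≤ √n * √((2 : ℝ) ^ β) := by positivity
  nlinarith [mul_le_mul_of_nonneg_left huv (by positivity : 0 ≤ 12 * (M + 1) + 1),
    mul_nonneg hM (by linarith : (0 : ℝ) ≤ n)]

/-! ### Summing over the blocks -/

/-- Bound on the regret suffered before block `β`, up to a constant factor: the geometric sum of the
bounds `√(n 2 ^ i)` of the earlier blocks `i < β` is at most four times the term of index `β`. -/
def blockBound (n β : ℕ) : ℝ := 4 * (√n * √(2 ^ β)) + n * β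

theorem blockBound_succ (n β : ℕ) :
    blockBound n β + (√n * √(2 ^ β) + n) ≤ blockBound n (β + 1) := by
  have h : (5 : ℝ) / 4 ≤ √2 := Real.le_sqrt_of_sq_le (by norm_num)
  have hw : 0 ≤ √n * √((2 : ℝ) ^ β) := by positivity
  rw [blockBound, blockBound, pow_succ, Real.sqrt_mul (by positivity)]
  push_cast
  nlinarith [mul_le_mul_of_nonneg_left h hw]

theorem IsRun.sum_block_le {u : Update} {A : Adversary n} {T : ℕ} {x : ℕ → Round n}
    (hn : 1 ≤ n) (hx : IsRun u A T x) {β a t : ℕ} {M : ℝ} (hM : 0 ≤ M) (hat : a ≤ t) (htT : t ≤ T)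
    (hb : ∀ s < t, a ≤ s → block x s = (β, a))
    (hS : ∑ s ∈ Finset.Ico a t, (x s).loss ≤ 2 ^ β + M) {φ : Op n} (hφ : IsState φ) :
    ∑ s ∈ Finset.Ico a t, ((x s).loss - (x s).lossOf φ) ≤
      (24 * (M + 1) + 2) * (√n * √(2 ^ β) + n) := by
  refine (sum_loss_sub_lossOf_le (rate_pos hn β) hat
    (fun s hs => hx.isMeasurement (hs.trans_le htT)) (fun s hs has => ?_) hφ).trans
    (rate_tradeoff hn β hM hS)
  rw [hx.eq_gibbs (hs.trans_le htT), exponent, hb s hs has]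

/-- At the beginning of round `t` in block `β`: the loss inside the block is at most `2 ^ β`, the
earlier blocks have cost at least `∑ 2 ^ i = 2 ^ β - 2` (over `1 ≤ i < β`), and the regret in them
against any fixed state is bounded by `blockBound`. -/
theorem IsRun.block_invariant {u : Update} {A : Adversary n} {T : ℕ} {x : ℕ → Round n} {B : ℝ}
    (hn : 1 ≤ n) (hA : ∀ t past ω, |A.target t past ω| ≤ B) (hx : IsRun u A T x) {t : ℕ}
    (ht : t ≤ T) :
    (∀ s ≤ t, (block x t).2 ≤ s → block x s = block x t) ∧
      ∑ s ∈ Finset.Ico (block x t).2 t, (x s).loss ≤ 2 ^ (block x t).1 ∧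
      2 ^ (block x t).1 - 2 ≤ ∑ s ∈ Finset.range (block x t).2, (x s).loss ∧
      ∀ φ, IsState φ → ∑ s ∈ Finset.range (block x t).2, ((x s).loss - (x s).lossOf φ) ≤
        (24 * ((1 + |B|) ^ 2 + 1) + 2) * blockBound n (block x t).1 := by
  induction t with
  | zero =>
    refine ⟨fun s hs _ => by rw [Nat.le_zero.1 hs], by simp [block], by simp [block],
      fun φ _ => ?_⟩
    simp only [block, Finset.range_zero, Finset.sum_empty, blockBound]
    positivity
  | succ t ih =>
    have htT : t < T := ht
    obtain ⟨h1, h2, h3, h4⟩ := ih htT.le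
    have hle := block_snd_le x t
    rw [block]
    split_ifs with hc
    · -- round `t` completes the block, overshooting `2 ^ β` by at most one loss
      have hIcc : Finset.Icc (block x t).2 t = Finset.Ico (block x t).2 (t + 1) := by
        ext s; simp
      rw [hIcc] at hc
      have hsplit := fun f : ℕ → ℝ =>
        (Finset.sum_range_add_sum_Ico f (hle.trans t.le_succ)).symm
      refine ⟨fun s hs hs' => ?_, by simp, ?_, fun φ hφ => ?_⟩
      · have hst : s = t + 1 := le_antisymm hs hs'
        rw [hst, block, hIcc, if_pos hc]
      · rw [hsplit, pow_succ]
        linarith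
      · have hloss : ∑ s ∈ Finset.Ico (block x t).2 (t + 1), (x s).loss ≤
            2 ^ (block x t).1 + (1 + |B|) ^ 2 := by
          rw [Finset.sum_Ico_succ_top hle]
          exact add_le_add h2 (hx.loss_le hA htT)
        have hreg := hx.sum_block_le hn (by positivity) (hle.trans t.le_succ) ht
          (fun s hs hs' => h1 s (Nat.le_of_lt_succ hs) hs') hloss hφ
        have hsucc := mul_le_mul_of_nonneg_left (blockBound_succ n (block x t).1)
          (by positivity : 0 ≤ 24 * ((1 + |B|) ^ 2 + 1) + 2)
        rw [hsplit]
        linarith [h4 φ hφ]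
    · refine ⟨fun s hs hs' => ?_, ?_, h3, h4⟩
      · rcases Nat.le_succ_iff.1 hs with h | h
        · exact h1 s h hs'
        · rw [h, block, if_neg hc]
      · have hIcc : Finset.Icc (block x t).2 t = Finset.Ico (block x t).2 (t + 1) := by
          ext s; simp
        rw [hIcc] at hc
        exact (not_le.1 hc).le

theorem bestLoss_nonneg (x : ℕ → Round n) (T : ℕ) : 0 ≤ bestLoss x T :=
  Real.iInf_nonneg fun _ => Finset.sum_nonneg fun _ _ => sq_nonneg _

theorem regret_le_of_forall {x : ℕ → Round n} {T : ℕ} {R : ℝ}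
    (h : ∀ φ, IsState φ → ∑ t ∈ Finset.range T, ((x t).loss - (x t).lossOf φ) ≤ R) :
    regret x T ≤ R := by
  have : Nonempty {φ : Op n // IsState φ} :=
    ⟨⟨gibbs 0, isState_gibbs Matrix.isHermitian_zero⟩⟩
  have hle : ∑ t ∈ Finset.range T, (x t).loss - R ≤ bestLoss x T := by
    refine le_ciInf fun φ => ?_
    have := h φ φ.2
    rw [Finset.sum_sub_distrib] at this
    linarith
  rw [regret]
  linarith

theorem sqrt_add_le {a b : ℝ} (ha : 0 ≤ a) (hb : 0 ≤ b) : √(a + b) ≤ √a + √b := by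
  refine Real.sqrt_le_left (by positivity) |>.2 ?_
  nlinarith [Real.sq_sqrt ha, Real.sq_sqrt hb, mul_nonneg (Real.sqrt_nonneg a) (Real.sqrt_nonneg b)]

/-- A quantity `R` that is at most of order `√(m (R + S)) + m l` is at most of order
`√(m S l) + m l`. Below, `R` is the regret, `S` the loss of the best state, `k` the number of blocks
and `p = 2 ^ k`. -/
theorem self_bounding {m R S l p k c D : ℝ} (hm : 1 ≤ m) (hS : 0 ≤ S) (hl : 1 / 2 ≤ l)
    (hD : 0 ≤ D) (hc : 0 ≤ c) (hp : p ≤ R + S + 2) (hk : k ≤ c * l)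
    (hR : R ≤ D * (6 * (√m * √p) + m * (k + 1))) :
    R ≤ (72 * D ^ 2 + 52 * D + 2 * c * D) * (√(m * S * l) + m * l) := by
  have hml : 0 < m * l := by positivity
  have hC : 0 ≤ 72 * D ^ 2 + 52 * D + 2 * c * D := by positivity
  rcases le_total R 0 with h0 | h0
  · exact h0.trans (by positivity)
  have hm2 : m ≤ 2 * (m * l) := by nlinarith
  have hsplit : √m * √p ≤ √(m * R) + √(m * S) + √(2 * m) := by
    rw [← Real.sqrt_mul (by linarith)]
    have h1 : √(m * p) ≤ √(m * R + m * S + 2 * m) := Real.sqrt_le_sqrt (by nlinarith)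
    have h2 := sqrt_add_le (a := m * R + m * S) (b := 2 * m) (by positivity) (by positivity)
    have h3 := sqrt_add_le (a := m * R) (b := m * S) (by positivity) (by positivity)
    linarith
  -- the part of the bound that contains `R` is absorbed into the left-hand side
  have hRR : 6 * D * √(m * R) ≤ R / 2 + 18 * D ^ 2 * m := by
    rw [Real.sqrt_mul (by linarith)]
    have h1 := Real.sq_sqrt h0
    have h2 := Real.sq_sqrt (by linarith : 0 ≤ m)
    nlinarith [sq_nonneg (√R - 6 * D * √m)]
  have hSS : √(m * S) ≤ 2 * √(m * S * l) := by
    rw [show (2 : ℝ) = √(2 ^ 2) from (Real.sqrt_sq (by norm_num)).symm,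
      ← Real.sqrt_mul (by norm_num)]
    exact Real.sqrt_le_sqrt (by nlinarith [mul_nonneg (by linarith : 0 ≤ m) hS])
  have h2m : √(2 * m) ≤ 2 * m := Real.sqrt_le_left (by linarith) |>.2 (by nlinarith)
  have hmk : m * (k + 1) ≤ (c + 2) * (m * l) := by nlinarith
  have e1 := mul_le_mul_of_nonneg_left hsplit (by positivity : 0 ≤ 6 * D)
  have e2 := mul_le_mul_of_nonneg_left hSS (by positivity : 0 ≤ 6 * D)
  have e3 := mul_le_mul_of_nonneg_left (h2m.trans (by linarith : 2 * m ≤ 4 * (m * l)))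
    (by positivity : 0 ≤ 6 * D)
  have e4 := mul_le_mul_of_nonneg_left hmk hD
  have e5 := mul_le_mul_of_nonneg_left hm2 (by positivity : 0 ≤ 18 * D ^ 2)
  have e6 : 0 ≤ (72 * D ^ 2 + 28 * D + 2 * c * D) * √(m * S * l) := by positivity
  linarith

theorem IsRun.regret_le {u : Update} {A : Adversary n} {T : ℕ} {x : ℕ → Round n} {B : ℝ}
    (hn : 1 ≤ n) (hT : 2 ≤ T) (hA : ∀ t past ω, |A.target t past ω| ≤ B) (hx : IsRun u A T x)
    {M D : ℝ} (hM : M = (1 + |B|) ^ 2) (hD : D = 24 * (M + 1) + 2) :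
    regret x T ≤ (72 * D ^ 2 + 52 * D + 2 * (4 * Real.log (M + 1) + 2) * D) *
      (√(n * bestLoss x T * Real.log T) + n * Real.log T) := by
  have hM0 : 0 ≤ M := hM ▸ sq_nonneg _
  have hD0 : 0 ≤ D := by rw [hD]; positivity
  have hn' : (1 : ℝ) ≤ n := by exact_mod_cast hn
  have hT' : (2 : ℝ) ≤ T := by exact_mod_cast hT
  have hlog2 : 1 / 2 ≤ Real.log 2 := by linarith [Real.log_two_gt_d9]
  have hl : 1 / 2 ≤ Real.log T := hlog2.trans (Real.log_le_log (by norm_num) hT')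
  have hlM : 0 ≤ Real.log (M + 1) := Real.log_nonneg (by linarith)
  obtain ⟨h1, h2, h3, h4⟩ := hx.block_invariant hn hA le_rfl
  have hle := block_snd_le x T
  set β := (block x T).1
  set a := (block x T).2
  have hsplit := fun f : ℕ → ℝ => (Finset.sum_range_add_sum_Ico f hle).symm
  have hpow : (2 : ℝ) ^ β ≤ ∑ t ∈ Finset.range T, (x t).loss + 2 := by
    have := Finset.sum_nonneg fun s (_ : s ∈ Finset.Ico a T) => (x s).loss_nonneg
    rw [hsplit]
    linarith
  have hL : ∑ t ∈ Finset.range T, (x t).loss ≤ T * M := by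
    have := Finset.sum_le_card_nsmul (Finset.range T) (fun t => (x t).loss) M
      fun t ht => hM ▸ hx.loss_le hA (Finset.mem_range.1 ht)
    simpa using this
  refine self_bounding (p := 2 ^ β) (k := β) hn' (bestLoss_nonneg x T) hl hD0 (by positivity)
    ?_ ?_ ?_
  · rw [regret]; linarith
  · have hp : (2 : ℝ) ^ β ≤ (M + 1) * T := by linarith
    have := Real.log_le_log (by positivity) hp
    rw [Real.log_pow, Real.log_mul (by positivity) (by positivity)] at this
    nlinarith [(Nat.cast_nonneg β : (0 : ℝ) ≤ β)]
  · refine regret_le_of_forall fun φ hφ => ?_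
    have hlast := hx.sum_block_le hn hM0 hle le_rfl (fun s hs hs' => h1 s hs.le hs')
      (h2.trans (by linarith)) hφ
    have hbefore := h4 φ hφ
    rw [← hM, ← hD] at hbefore
    rw [← hD] at hlast
    rw [hsplit]
    have hw : 0 ≤ √n * √((2 : ℝ) ^ β) := by positivity
    have : D * blockBound n β + D * (√n * √(2 ^ β) + n) ≤
        D * (6 * (√n * √(2 ^ β)) + n * (β + 1)) := by
      rw [← mul_add, blockBound]
      exact mul_le_mul_of_nonneg_left (by linarith) hD0
    linarith

end

end QuantumOnline

theorem theorem2 (B : ℝ) :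
    ∃ C : ℝ, ∀ (n : ℕ), 1 ≤ n → ∀ (T : ℕ), 2 ≤ T →
      ∀ (u : QuantumOnline.Update) (A : QuantumOnline.Adversary n),
        (∀ t past ω, |A.target t past ω| ≤ B) →
        (∃ x : ℕ → QuantumOnline.Round n, QuantumOnline.IsRun u A T x) ∧
        ∀ x : ℕ → QuantumOnline.Round n, QuantumOnline.IsRun u A T x →
          QuantumOnline.regret x T ≤
            C * (√(n * QuantumOnline.bestLoss x T * Real.log T) + n * Real.log T) :=
  ⟨_, fun _ hn T hT u A hA => ⟨QuantumOnline.exists_isRun u A T,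
    fun _ hx => hx.regret_le hn hT hA rfl rfl⟩⟩
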